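/- Let $\tfrac12<H<1$, $T>0$, and let $X^1,\dots,X^N$ be observed on $[0,T]$, where $$dX^i_t=\phi_i\,S(X^i_t)\,dt+d\tilde W^{H,i}_t,\qquad X^i_0=x^i,$$ the $\tilde W^{H,i}$ are independent mixed fractional Brownian motions (each the sum of a standard Brownian motion and an independent fractional Brownian motion with Hurst index $H$), $S$ is a known measurable function, and the random effects $\phi_1,\dots,\phi_N$ are i.i.d. and independent of the $\tilde W^{H,i}$. They have a density $g(\psi,\theta)$, $\theta=(\mu,\sigma_0^2)$, with respect to a $\sigma$-finite measure $\nu$ on $\mathbb R$, such that $g(\psi,\theta)\,d\nu(\psi)$ is the Gaussian law with mean $\mu\in\mathbb R$ (unknown) and variance $\sigma_0^2>0$ (known). It is assumed that $X^i$ is a strong solution and that $S(X^i)$ is a.s. integrable on $[0,T]$. For $0<t\le T$ let $g_H(\cdot,t)$ be the continuous solution of $$g_H(s,t)+H\frac{d}{ds}\int_0^t g_H(r,t)\,|s-r|^{2H-1}\operatorname{sign}(s-r)\,dr=1,\qquad 0<s<t,$$ and put $w_t=\int_0^t g_H(s,t)\,ds$, $Z_i(t)=\int_0^t g_H(s,t)\,dX^i_s$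 and $Q_i(t)=\frac{d}{dw_t}\int_0^t g_H(s,t)\,S(X^i_s)\,ds$ (the density with respect to the measure $dw$, assumed to exist and to satisfy $\int_0^T Q_i^2\,dw<\infty$ a.s.). Let $$U_i=\int_0^T Q_i(t)\,dZ_i(t)\ \text{(Itô integral)},\qquad V_i=\int_0^T Q_i(t)^2\,dw_t .$$ Consider the likelihood $$L_N(\mu)=\prod_{i=1}^N\lambda_i(\mu),\qquad \lambda_i(\mu)=\int_{\mathbb R} g(\psi,(\mu,\sigma_0^2))\exp\Big(\psi U_i-\tfrac12\psi^2V_i\Big)\,d\nu(\psi).$$ Then, almost surely, all these integrals converge and, whenever $\sum_{i=1}^N \frac{V_i}{1+\sigma_0^2V_i}\neq0$, the maximum likelihood estimate of $\mu$, that is, the point at which $L_N$ attains its supremum over $\mu\in\mathbb R$, exists, is unique and equals $$\hat\mu_N=\sum_{i=1}^N\frac{U_i}{1+\sigma_0^2V_i}\Big/\sum_{i=1}^N\frac{V_i}{1+\sigma_0^2V_i}.$$ -/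

import Mathlib

open MeasureTheory ProbabilityTheory Filter Set
open scoped NNReal ENNReal Topology

noncomputable section

namespace MixedFBM

variable {Ω : Type*} [MeasurableSpace Ω]

/-! ### Mixed fractional Brownian motion -/

/-- Normalized fractional Brownian motion with Hurst index `H`. -/
structure IsFractionalBrownian (H : ℝ) (B : ℝ≥0 → Ω → ℝ) (P : Measure Ω) : Prop where
  gaussian : IsGaussianProcess B P
  zero : ∀ᵐ ω ∂P, B 0 ω = 0
  mean : ∀ t, ∫ ω, B t ω ∂P = 0
  covariance : ∀ s t : ℝ≥0, ∫ ω, B s ω * B t ω ∂P =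
    1 / 2 * ((s : ℝ) ^ (2 * H) + (t : ℝ) ^ (2 * H) - |(s : ℝ) - t| ^ (2 * H))
  cont : ∀ᵐ ω ∂P, Continuous (fun t => B t ω)

/-- Mixed fractional Brownian motion: the sum of a standard Brownian motion and an independent
fractional Brownian motion with Hurst index `H`. -/
def IsMixedFractionalBrownian (H : ℝ) (B : ℝ≥0 → Ω → ℝ) (P : Measure Ω) : Prop :=
  ∃ W WH : ℝ≥0 → Ω → ℝ, IsBrownianReal W P ∧ IsFractionalBrownian H WH P ∧
    IndepFun (fun ω t => W t ω) (fun ω t => WH t ω) P ∧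
    ∀ t ω, B t ω = W t ω + WH t ω

/-! ### The integral transform of Cai, Chigansky and Kleptsyna -/

/-- `g s t` (for `0 ≤ s ≤ t`, `0 < t ≤ T`) is the solution, continuous in `s`, of
`g(s,t) + H d/ds ∫₀ᵗ g(r,t) |s-r|^{2H-1} sign(s-r) dr = 1`, `0 < s < t`. -/
structure IsTransformKernel (H : ℝ) (T : ℝ≥0) (g : ℝ → ℝ → ℝ) : Prop where
  cont : ∀ t : ℝ, 0 < t → t ≤ T → ContinuousOn (fun s => g s t) (Icc 0 t)
  diff : ∀ t : ℝ, 0 < t → t ≤ T → ∀ s ∈ Ioo 0 t,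
    DifferentiableAt ℝ
      (fun s => ∫ r in (0 : ℝ)..t, g r t * |s - r| ^ (2 * H - 1) * Real.sign (s - r)) s
  eqn : ∀ t : ℝ, 0 < t → t ≤ T → ∀ s ∈ Ioo 0 t,
    g s t + H * deriv
      (fun s => ∫ r in (0 : ℝ)..t, g r t * |s - r| ^ (2 * H - 1) * Real.sign (s - r)) s = 1

/-- The function `w_t = ⟨M^H⟩_t = ∫₀ᵗ g(s,t) ds`. -/
def bracket (g : ℝ → ℝ → ℝ) (t : ℝ) : ℝ := ∫ s in (0 : ℝ)..t, g s t

open Classical in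
/-- The Lebesgue–Stieltjes measure `dw` on `[0,T]`: `w` is extended by constants outside `[0,T]`.
(The function `w` of the transform kernel is nondecreasing; the value `0` is a convention for
other functions.) -/
def bracketMeasure (g : ℝ → ℝ → ℝ) (T : ℝ≥0) : Measure ℝ :=
  if h : Monotone (fun t : ℝ => bracket g (max 0 (min (T : ℝ) t))) then
    h.stieltjesFunction.measure
  else 0

/-- `0 = τ 0 ≤ τ 1 ≤ … ≤ τ n = t`. -/
structure IsPartition (t : ℝ≥0) (n : ℕ) (τ : ℕ → ℝ≥0) : Prop where
  mono : Monotone τ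
  left : τ 0 = 0
  right : τ n = t

/-- `I` is (a version of) `∫₀ᵗ f(s) dX_s` for a deterministic continuous integrand `f`: the limit in
probability of the Riemann sums along every sequence of partitions with mesh tending to `0`. -/
def IsRiemannIntegral (P : Measure Ω) (f : ℝ → ℝ) (X : ℝ≥0 → Ω → ℝ) (t : ℝ≥0) (I : Ω → ℝ) :
    Prop :=
  ∀ (n : ℕ → ℕ) (τ : ℕ → ℕ → ℝ≥0), (∀ m, IsPartition t (n m) (τ m)) →
    (∀ ε : ℝ, 0 < ε → ∀ᶠ m in atTop, ∀ k < n m, (τ m (k + 1) : ℝ) - τ m k < ε) →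
    TendstoInMeasure P
      (fun m ω => ∑ k ∈ Finset.range (n m), f (τ m k) * (X (τ m (k + 1)) ω - X (τ m k) ω))
      atTop I

/-- `Z_t = ∫₀ᵗ g(s,t) dX_s` for `0 ≤ t ≤ T`. -/
def IsTransform (P : Measure Ω) (g : ℝ → ℝ → ℝ) (T : ℝ≥0) (X Z : ℝ≥0 → Ω → ℝ) : Prop :=
  ∀ t ≤ T, IsRiemannIntegral P (fun s => g s t) X t (Z t)

/-- `Q(t) = d/dw_t ∫₀ᵗ g(s,t) C(s) ds` on `[0,T]`, almost surely: `Q` is the density of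
`t ↦ ∫₀ᵗ g(s,t) C(s) ds` with respect to `dw`. -/
def IsBracketDerivative (P : Measure Ω) (g : ℝ → ℝ → ℝ) (T : ℝ≥0) (C Q : ℝ → Ω → ℝ) : Prop :=
  ∀ᵐ ω ∂P, Integrable (fun s => Q s ω) (bracketMeasure g T) ∧
    ∀ t ∈ Icc (0 : ℝ) T,
      ∫ s in (0 : ℝ)..t, g s t * C s ω = ∫ s in Ioc 0 t, Q s ω ∂(bracketMeasure g T)

/-! ### Itô integral -/

/-- The σ-algebra generated by `X_s`, `s ≤ t`. -/
abbrev pathSigma (X : ℝ≥0 → Ω → ℝ) (t : ℝ≥0) : MeasurableSpace Ω :=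
  ⨆ s : Iic t, MeasurableSpace.comap (X s) inferInstance

/-- Bounded simple integrands `∑ ξ_k 1_{(τ_k, τ_{k+1}]}` on `[0,T]`, with `ξ_k` measurable with
respect to `F (τ_k)`. -/
structure SimpleIntegrand (F : ℝ≥0 → MeasurableSpace Ω) (T : ℝ≥0) where
  n : ℕ
  τ : ℕ → ℝ≥0
  ξ : ℕ → Ω → ℝ
  partition : IsPartition T n τ
  meas : ∀ k, Measurable[F (τ k)] (ξ k)
  bdd : ∀ k, ∃ C : ℝ, ∀ ω, |ξ k ω| ≤ C

/-- The value `K_s(ω)` of a simple integrand. -/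
def SimpleIntegrand.eval {F : ℝ≥0 → MeasurableSpace Ω} {T : ℝ≥0} (K : SimpleIntegrand F T)
    (s : ℝ) (ω : Ω) : ℝ :=
  ∑ k ∈ Finset.range K.n, (Ioc (K.τ k : ℝ) (K.τ (k + 1))).indicator (fun _ => K.ξ k ω) s

/-- The elementary integral `∫₀ᵀ K dZ = ∑ ξ_k (Z_{τ_{k+1}} - Z_{τ_k})`. -/
def SimpleIntegrand.integral {F : ℝ≥0 → MeasurableSpace Ω} {T : ℝ≥0} (K : SimpleIntegrand F T)
    (Z : ℝ≥0 → Ω → ℝ) (ω : Ω) : ℝ :=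
  ∑ k ∈ Finset.range K.n, K.ξ k ω * (Z (K.τ (k + 1)) ω - Z (K.τ k) ω)

/-- `U` is (a version of) the Itô integral `∫₀ᵀ Q dZ`, where the martingale part of `Z` has the
deterministic bracket measure `m` on `[0,T]`: there are simple `F`-predictable integrands `K_j` with
`∫₀ᵀ (K_j - Q)² dm → 0` in probability and `∫₀ᵀ K_j dZ → U` in probability. -/
def IsItoIntegral (P : Measure Ω) (F : ℝ≥0 → MeasurableSpace Ω) (m : Measure ℝ) (T : ℝ≥0)
    (Q : ℝ → Ω → ℝ) (Z : ℝ≥0 → Ω → ℝ) (U : Ω → ℝ) : Prop :=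
  ∃ K : ℕ → SimpleIntegrand F T,
    (∀ ε : ℝ≥0∞, 0 < ε → Tendsto
      (fun j => P {ω | ε ≤ ∫⁻ s in Ioc 0 (T : ℝ), ENNReal.ofReal (((K j).eval s ω - Q s ω) ^ 2) ∂m})
      atTop (𝓝 0)) ∧
    TendstoInMeasure P (fun j => (K j).integral Z) atTop U

/-! ### The random-effects model -/

/-- The processes `X^1, …, X^N` solve, on `[0,T]`,
`dX^i_t = φ_i S(X^i_t) dt + dB^i_t`, `X^i_0 = x^i`, where the `B^i` are independent mixed
fractional Brownian motions with Hurst index `H` and the random effects `φ_i` are i.i.d. with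
law `ρ`, independent of the `B^i`. -/
structure IsLinearRandomEffectModel (P : Measure Ω) (H : ℝ) (T : ℝ≥0) (N : ℕ) (S : ℝ → ℝ)
    (ρ : Measure ℝ) (x : Fin N → ℝ) (φ : Fin N → Ω → ℝ) (B X : Fin N → ℝ≥0 → Ω → ℝ) : Prop where
  noise : ∀ i, IsMixedFractionalBrownian H (B i) P
  noise_indep : iIndepFun (fun i ω t => B i t ω) P
  effect_meas : ∀ i, Measurable (φ i)
  effect_law : ∀ i, P.map (φ i) = ρ
  effect_indep : iIndepFun φ P
  effect_noise_indep : IndepFun (fun ω i => φ i ω) (fun ω i t => B i t ω) P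
  state_meas : ∀ i t, Measurable (X i t)
  /-- `X^i` is a strong solution: up to null sets, `X^i_t` is a function of `φ_i` and of the noise
  up to time `t`. -/
  nonanticipative : ∀ i, ∀ t ≤ T, ∃ Y : Ω → ℝ,
    Measurable[MeasurableSpace.comap (φ i) inferInstance ⊔ pathSigma (B i) t] Y ∧ X i t =ᵐ[P] Y
  drift_integrable : ∀ i, ∀ᵐ ω ∂P,
    IntervalIntegrable (fun s : ℝ => S (X i s.toNNReal ω)) volume 0 T
  sde : ∀ i, ∀ᵐ ω ∂P, ∀ t ≤ T,
    X i t ω = x i + (∫ s in (0 : ℝ)..t, φ i ω * S (X i s.toNNReal ω)) + B i t ω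

/-! ### The likelihood -/

/-- `λ = ∫ p(ψ,θ) exp(ψ u - ψ² v / 2) dν(ψ)`, as a function of the values `u`, `v` of the
functionals `U_i`, `V_i`. -/
def lik {Θ : Type*} (p : ℝ → Θ → ℝ) (ν : Measure ℝ) (θ : Θ) (u v : ℝ) : ℝ :=
  ∫ ψ, p ψ θ * Real.exp (ψ * u - 1 / 2 * ψ ^ 2 * v) ∂ν

/-- `V = ∫₀ᵀ Q² dw`. -/
def quadFunctional (g : ℝ → ℝ → ℝ) (T : ℝ≥0) (Q : ℝ → Ω → ℝ) (ω : Ω) : ℝ :=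
  ∫ s in Ioc 0 (T : ℝ), Q s ω ^ 2 ∂(bracketMeasure g T)

/-- `a` is a maximum likelihood estimate for the likelihood function `L`: `L a = sup L`. -/
def IsMLE {A : Type*} (L : A → ℝ) (a : A) : Prop := IsLUB (range L) (L a)

end MixedFBM

end

/-!
The likelihood of one observation is a Gaussian integral. Since `V i` is almost surely the integral
of a square, it is nonnegative, and the product of the density of `N(μ, σ²)` with
`exp (ψ u - ψ² v / 2)` is a constant multiple of the density of the Gaussian law with mean
`(μ + σ² u) / (1 + σ² v)` and variance `σ² / (1 + σ² v)` (`gaussianPDFReal_mul_exp_quadratic`).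
That constant is the likelihood (`lik_eq_of_withDensity_eq_gaussianReal`); as a function of `μ` it
is proportional to `exp (μ u / (1 + σ² v) - μ² / 2 * (v / (1 + σ² v)))`.

The product over the observations is therefore `C * exp (μ A - μ² D / 2)` with `C > 0`,
`A = ∑ U i / (1 + σ² V i)` and `D = ∑ V i / (1 + σ² V i) ≥ 0`. When `D ≠ 0`, the exponent is a
strictly concave quadratic polynomial in `μ`, with unique maximizer `A / D`
(`isMLE_const_mul_exp_quadratic_iff`).

The argument is pathwise. The exceptional null set is the one outside which `V i` agrees with the
integral that defines it, so that `V i ≥ 0`.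
-/

namespace MixedFBM

/-- The integral of `exp (ψ u - ψ² v / 2)` against `N(μ, s)` for `v ≥ 0`, in closed form. -/
noncomputable def gaussianLik (μ : ℝ) (s : ℝ≥0) (u v : ℝ) : ℝ :=
  Real.exp ((2 * μ * u + s * u ^ 2 - μ ^ 2 * v) / (2 * (1 + s * v))) / √(1 + s * v)

/-- Completing the square: exponential tilting by a concave quadratic polynomial turns a Gaussian
density into a multiple of another one. -/
lemma gaussianPDFReal_mul_exp_quadratic (μ : ℝ) {s : ℝ≥0} (hs : 0 < s) (u : ℝ) (v : ℝ≥0) (ψ : ℝ) :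
    gaussianPDFReal μ s ψ * Real.exp (ψ * u - 1 / 2 * ψ ^ 2 * v) =
      gaussianLik μ s u v *
        gaussianPDFReal ((μ + s * u) / (1 + s * v)) (s / (1 + s * v)) ψ := by
  have hs' : (0 : ℝ) < s := hs
  have hd : (0 : ℝ) < 1 + s * v := by positivity
  have hsqrt : √(2 * Real.pi * (s / (1 + s * v))) = √(2 * Real.pi * s) / √(1 + s * v) := by
    rw [← mul_div_assoc, Real.sqrt_div (by positivity)]
  have h1 : √(2 * Real.pi * s) ≠ 0 := by positivity
  have h2 : √(1 + s * v : ℝ) ≠ 0 := by positivity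
  simp only [gaussianPDFReal, gaussianLik, NNReal.coe_div, NNReal.coe_add, NNReal.coe_one,
    NNReal.coe_mul, hsqrt]
  have hexp : -(ψ - μ) ^ 2 / (2 * s) + (ψ * u - 1 / 2 * ψ ^ 2 * v) =
      (2 * μ * u + s * u ^ 2 - μ ^ 2 * v) / (2 * (1 + s * v)) +
        -(ψ - (μ + s * u) / (1 + s * v)) ^ 2 / (2 * (s / (1 + s * v))) := by
    field_simp
    ring
  rw [mul_assoc, ← Real.exp_add, hexp, Real.exp_add]
  field_simp

lemma integral_exp_quadratic_gaussianReal (μ : ℝ) {s : ℝ≥0} (hs : 0 < s) (u : ℝ) (v : ℝ≥0) :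
    ∫ ψ, Real.exp (ψ * u - 1 / 2 * ψ ^ 2 * v) ∂gaussianReal μ s = gaussianLik μ s u v := by
  rw [integral_gaussianReal_eq_integral_smul hs.ne']
  simp only [smul_eq_mul, gaussianPDFReal_mul_exp_quadratic μ hs, integral_const_mul]
  rw [integral_gaussianPDFReal_eq_one, mul_one]
  positivity

lemma integrable_exp_quadratic_gaussianReal (μ : ℝ) (s : ℝ≥0) (u : ℝ) (v : ℝ≥0) :
    Integrable (fun ψ => Real.exp (ψ * u - 1 / 2 * ψ ^ 2 * v)) (gaussianReal μ s) := by
  refine (integrable_exp_mul_gaussianReal (μ := μ) (v := s) u).mono' (by fun_prop) ?_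
  refine ae_of_all _ fun ψ => ?_
  rw [Real.norm_eq_abs, Real.abs_exp, Real.exp_le_exp]
  nlinarith [mul_nonneg (sq_nonneg ψ) v.2]

section WithDensity

variable {ν : Measure ℝ} {f : ℝ → ℝ} {μ : ℝ} {s : ℝ≥0}

lemma integrable_mul_exp_quadratic (hf : Measurable f) (hf0 : ∀ ψ, 0 ≤ f ψ)
    (h : ν.withDensity (fun ψ => ENNReal.ofReal (f ψ)) = gaussianReal μ s) (u : ℝ) (v : ℝ≥0) :
    Integrable (fun ψ => f ψ * Real.exp (ψ * u - 1 / 2 * ψ ^ 2 * v)) ν := by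
  have hint := integrable_exp_quadratic_gaussianReal μ s u v
  rw [← h, integrable_withDensity_iff_integrable_smul' (by fun_prop)
    (ae_of_all _ fun _ => ENNReal.ofReal_lt_top)] at hint
  simpa only [ENNReal.toReal_ofReal (hf0 _), smul_eq_mul] using hint

lemma lik_eq_of_withDensity_eq_gaussianReal {Θ : Type*} {p : ℝ → Θ → ℝ} {θ : Θ}
    (hp : Measurable fun ψ => p ψ θ) (hp0 : ∀ ψ, 0 ≤ p ψ θ)
    (h : ν.withDensity (fun ψ => ENNReal.ofReal (p ψ θ)) = gaussianReal μ s) (hs : 0 < s)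
    (u : ℝ) (v : ℝ≥0) :
    lik p ν θ u v = gaussianLik μ s u v := by
  rw [← integral_exp_quadratic_gaussianReal μ hs u v, ← h,
    integral_withDensity_eq_integral_toReal_smul (by fun_prop)
      (ae_of_all _ fun _ => ENNReal.ofReal_lt_top)]
  simp only [ENNReal.toReal_ofReal (hp0 _), smul_eq_mul, lik]

end WithDensity

/-- The likelihood as a function of the mean `μ`: it is its value at `μ = 0` times the exponential
of a quadratic polynomial. -/
lemma gaussianLik_eq_mul_exp (μ : ℝ) (s : ℝ≥0) (u : ℝ) (v : ℝ≥0) :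
    gaussianLik μ s u v = gaussianLik 0 s u v *
      Real.exp (μ * (u / (1 + s * v)) - μ ^ 2 / 2 * (v / (1 + s * v))) := by
  have hd : (1 + s * v : ℝ) ≠ 0 := by positivity
  rw [gaussianLik, gaussianLik, div_mul_eq_mul_div, ← Real.exp_add]
  congr 2
  field_simp
  ring

lemma gaussianLik_pos (μ : ℝ) (s : ℝ≥0) (u : ℝ) (v : ℝ≥0) : 0 < gaussianLik μ s u v := by
  unfold gaussianLik
  positivity

lemma isMLE_const_mul_exp_quadratic_iff {C A D : ℝ} (hC : 0 < C) (hD : 0 < D) (m : ℝ) :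
    IsMLE (fun μ : ℝ => C * Real.exp (μ * A - μ ^ 2 / 2 * D)) m ↔ m = A / D := by
  have hsq (μ : ℝ) : μ * A - μ ^ 2 / 2 * D = A ^ 2 / (2 * D) - D / 2 * (μ - A / D) ^ 2 := by
    field_simp
    ring
  have hle (μ μ' : ℝ) : C * Real.exp (μ * A - μ ^ 2 / 2 * D) ≤
      C * Real.exp (μ' * A - μ' ^ 2 / 2 * D) ↔ (μ' - A / D) ^ 2 ≤ (μ - A / D) ^ 2 := by
    rw [mul_le_mul_iff_right₀ hC, Real.exp_le_exp, hsq, hsq, sub_le_sub_iff_left,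
      mul_le_mul_iff_right₀ (by positivity)]
  constructor
  · intro h
    have h0 := (hle _ _).1 (h.1 (mem_range_self (A / D)))
    rw [sub_self, zero_pow two_ne_zero] at h0
    exact sub_eq_zero.1 (pow_eq_zero_iff two_ne_zero |>.1 (h0.antisymm (sq_nonneg _)))
  · rintro rfl
    refine IsGreatest.isLUB ⟨mem_range_self _, ?_⟩
    rintro _ ⟨μ, rfl⟩
    refine (hle _ _).2 ?_
    rw [sub_self, zero_pow two_ne_zero]
    positivity

lemma quadFunctional_nonneg {Ω : Type*} (g : ℝ → ℝ → ℝ) (T : ℝ≥0) (Q : ℝ → Ω → ℝ) (ω : Ω) :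
    0 ≤ quadFunctional g T Q ω :=
  integral_nonneg fun _ => sq_nonneg _

end MixedFBM

theorem mainTheorem1 {Ω : Type*} [MeasurableSpace Ω] (P : Measure Ω) [IsProbabilityMeasure P]
    (H : ℝ) (hH : 1 / 2 < H) (hH1 : H < 1) (T : ℝ≥0) (hT : 0 < T) (N : ℕ)
    (S : ℝ → ℝ) (hS : Measurable S)
    -- the density `p(ψ,θ)`, `θ = (μ, σ²)`, with respect to `ν`, is that of `N(μ, σ₀²)`
    (p : ℝ → ℝ × ℝ≥0 → ℝ) (ν : Measure ℝ) [SigmaFinite ν]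
    (σ2 : ℝ≥0) (hσ : 0 < σ2)
    (hp_meas : ∀ μ : ℝ, Measurable (fun ψ => p ψ (μ, σ2)))
    (hp_nonneg : ∀ (ψ μ : ℝ), 0 ≤ p ψ (μ, σ2))
    (hp_gauss : ∀ μ : ℝ,
      ν.withDensity (fun ψ => ENNReal.ofReal (p ψ (μ, σ2))) = gaussianReal μ σ2)
    -- the observed processes, with true parameter `(μ₀, σ₀²)`
    (μ₀ : ℝ) (x : Fin N → ℝ) (φ : Fin N → Ω → ℝ) (B X : Fin N → ℝ≥0 → Ω → ℝ)
    (hX : MixedFBM.IsLinearRandomEffectModel P H T N S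
      (ν.withDensity (fun ψ => ENNReal.ofReal (p ψ (μ₀, σ2)))) x φ B X)
    -- the transform, and the functionals `U_i`, `V_i`
    (g : ℝ → ℝ → ℝ) (hg : MixedFBM.IsTransformKernel H T g)
    (Z : Fin N → ℝ≥0 → Ω → ℝ) (hZ : ∀ i, MixedFBM.IsTransform P g T (X i) (Z i))
    (Q : Fin N → ℝ → Ω → ℝ)
    (hQ : ∀ i, MixedFBM.IsBracketDerivative P g T (fun s ω => S (X i s.toNNReal ω)) (Q i))
    (hQ2 : ∀ i, ∀ᵐ ω ∂P, Integrable (fun s => Q i s ω ^ 2) (MixedFBM.bracketMeasure g T))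
    (U V : Fin N → Ω → ℝ)
    (hU : ∀ i, MixedFBM.IsItoIntegral P (MixedFBM.pathSigma (X i)) (MixedFBM.bracketMeasure g T) T
      (Q i) (Z i) (U i))
    (hV : ∀ i, V i =ᵐ[P] MixedFBM.quadFunctional g T (Q i)) :
    ∀ᵐ ω ∂P,
      (∀ (i : Fin N) (μ : ℝ),
        Integrable (fun ψ => p ψ (μ, σ2) * Real.exp (ψ * U i ω - 1 / 2 * ψ ^ 2 * V i ω)) ν) ∧
      (∑ i, V i ω / (1 + σ2 * V i ω) ≠ 0 →
        ∀ m : ℝ,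
          MixedFBM.IsMLE (fun μ : ℝ => ∏ i, MixedFBM.lik p ν (μ, σ2) (U i ω) (V i ω)) m ↔
            m = (∑ i, U i ω / (1 + σ2 * V i ω)) / (∑ i, V i ω / (1 + σ2 * V i ω))) := by
  have hV0 : ∀ᵐ ω ∂P, ∀ i, 0 ≤ V i ω := ae_all_iff.2 fun i => by
    filter_upwards [hV i] with ω hω
    exact hω ▸ MixedFBM.quadFunctional_nonneg g T (Q i) ω
  filter_upwards [hV0] with ω hω
  obtain ⟨v, hv⟩ : ∃ v : Fin N → ℝ≥0, ∀ i, V i ω = v i := ⟨fun i => ⟨V i ω, hω i⟩, fun _ => rfl⟩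
  simp only [hv]
  refine ⟨fun i μ => MixedFBM.integrable_mul_exp_quadratic (hp_meas μ) (fun ψ => hp_nonneg ψ μ)
    (hp_gauss μ) (U i ω) (v i), fun hD m => ?_⟩
  have hD' : 0 < ∑ i, (v i : ℝ) / (1 + σ2 * v i) :=
    (Finset.sum_nonneg fun i _ => by positivity).lt_of_ne' hD
  have hC : 0 < ∏ i, MixedFBM.gaussianLik 0 σ2 (U i ω) (v i) :=
    Finset.prod_pos fun i _ => MixedFBM.gaussianLik_pos 0 σ2 (U i ω) (v i)
  have hL : (fun μ : ℝ => ∏ i, MixedFBM.lik p ν (μ, σ2) (U i ω) (v i)) = fun μ : ℝ =>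
      (∏ i, MixedFBM.gaussianLik 0 σ2 (U i ω) (v i)) *
        Real.exp (μ * (∑ i, U i ω / (1 + σ2 * v i)) -
          μ ^ 2 / 2 * ∑ i, (v i : ℝ) / (1 + σ2 * v i)) := by
    funext μ
    simp only [MixedFBM.lik_eq_of_withDensity_eq_gaussianReal (hp_meas μ)
      (fun ψ => hp_nonneg ψ μ) (hp_gauss μ) hσ, MixedFBM.gaussianLik_eq_mul_exp μ]
    rw [Finset.prod_mul_distrib, ← Real.exp_sum, Finset.sum_sub_distrib, Finset.mul_sum,
      Finset.mul_sum]
  rw [hL]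
  exact MixedFBM.isMLE_const_mul_exp_quadratic_iff hC hD' m
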